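/- Let $F$ be a field with $\operatorname{char} F\neq 2,3$, let $K/F$ be a quadratic étale extension (a commutative étale $F$-algebra of dimension $2$, possibly split) and let $\sigma$ be its non-trivial $F$-automorphism. A *hermitian cubic norm structure* over $K/F$ is a quadruple $\mathcal K=(J,N,\sharp,T)$, where $J$ is a $K$-module, $N\colon J\to K$ is a non-zero map, $\sharp\colon J\to J$ is a map such that $a\times b:=(a+b)^\sharp-a^\sharp-b^\sharp$ is $\sigma$-semilinear in each of $a$ and $b$, and $T\colon J\times J\to K$ is a hermitian form (biadditive, $T(sa,tb)=s\,t^\sigma\,T(a,b)$, $T(a,b)^\sigma=T(b,a)$), such that for all $t\in K$ and $a,b\in J$: (i) $(ta)^\sharp=(t^{\sigma})^2a^\sharp$; (ii) $N(ta)=t^3N(a)$; (iii) $N(a+b)=N(a)+T(b,a^\sharp)+T(a,b^\sharp)+N(b)$; (iv) $a^{\sharp\sharp}=N(a)a$. A *structurable algebra* over $F$ is a unital, not necessarily associative or commutative $F$-algebra $\mathcal A$ with an $F$-linear involution $x\mapsto\overline x$ (so $\overline{\overline x}=x$ and $\overline{xy}=\overline y\,\overline x$) such that the operators $V_{x,y}(z):=(x\overline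 y)z+(z\overline y)x-(z\overline x)y$ satisfy $[V_{x,y},V_{z,w}]=V_{V_{x,y}(z),w}-V_{z,V_{y,x}(w)}$ for all $x,y,z,w\in\mathcal A$. It has *skew-dimension one* if $\{x\in\mathcal A:\overline x=-x\}$ is one-dimensional over $F$. It is *central* if the only elements $x=\overline x$ that commute and associate with all elements of $\mathcal A$ are those of $F\cdot 1$, and *simple* if $\mathcal A\neq 0$ and its only two-sided ideals stable under the involution are $0$ and $\mathcal A$. Let $\mathcal K=(J,N,\sharp,T)$ be a hermitian cubic norm structure over $K/F$, and let $\mathcal A=K\oplus J$ as an $F$-vector space, with involution $\overline{(s,b)}:=(s^\sigma,b)$ and multiplication $$(s,b)(t,c):=\bigl(st+T(b,c),\;sc+t^\sigma b+b\times c\bigr)\qquad(s,t\in K,\ b,c\in J).$$ Then $\mathcal A$ is a structurable $F$-algebra of skew-dimension one, denoted $\mathcal A(\mathcal K)$. Moreover, if $T$ is non-degenerate, then $\mathcal A$ is a central simple structurable $F$-algebra. -/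

import Mathlib

/-! ### Structurable algebras

`A` is a unital, not necessarily associative `F`-algebra and `bar : A →ₗ[F] A` is its involution.
-/

namespace Structurable

section

variable {F A : Type*} [Field F] [NonAssocRing A] [Module F A] [IsScalarTower F A A]
  [SMulCommClass F A A]

/-- The operator `V_{x,y} : z ↦ (x ȳ) z + (z ȳ) x - (z x̄) y`. -/
def V (bar : A →ₗ[F] A) (x y : A) : Module.End F A :=
  LinearMap.mulLeft F (x * bar y)
    + LinearMap.mulRight F x ∘ₗ LinearMap.mulRight F (bar y)
    - LinearMap.mulRight F y ∘ₗ LinearMap.mulRight F (bar x)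

theorem V_apply (bar : A →ₗ[F] A) (x y z : A) :
    V bar x y z = (x * bar y) * z + (z * bar y) * x - (z * bar x) * y := rfl

/-- `(A, bar)` is a structurable algebra over `F` (where `F` has characteristic not `2` or `3`):
`bar` is an `F`-linear involution, and
`[V_{x,y}, V_{z,w}] = V_{V_{x,y}(z), w} - V_{z, V_{y,x}(w)}` in `End_F(A)`. -/
structure IsStructurable (bar : A →ₗ[F] A) : Prop where
  bar_bar : ∀ x : A, bar (bar x) = x
  bar_mul : ∀ x y : A, bar (x * y) = bar y * bar x
  bracket_V : ∀ x y z w : A,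
    ⁅V bar x y, V bar z w⁆ = V bar (V bar x y z) w - V bar z (V bar y x w)

/-- The space `𝓢` of skew elements, `x̄ = -x`. -/
def skew (bar : A →ₗ[F] A) : Submodule F A where
  carrier := {x | bar x = -x}
  add_mem' := by
    intro x y hx hy
    simp only [Set.mem_ofPred_eq] at hx hy ⊢
    rw [map_add, hx, hy, neg_add]
  zero_mem' := by simp
  smul_mem' := by
    intro r x hx
    simp only [Set.mem_ofPred_eq] at hx ⊢
    rw [map_smul, hx, smul_neg]

/-- The space of skew elements is one-dimensional over `F`. -/
def HasSkewDimensionOne (bar : A →ₗ[F] A) : Prop :=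
  Module.finrank F (skew bar) = 1

/-- The center of `(A, bar)`: the hermitian elements that commute and associate with everything. -/
def center (bar : A →ₗ[F] A) : Set A :=
  {x | bar x = x ∧ (∀ a : A, x * a = a * x) ∧
    (∀ a b : A, associator x a b = 0) ∧ (∀ a b : A, associator a x b = 0) ∧
    (∀ a b : A, associator a b x = 0)}

/-- `(A, bar)` is central over `F`: its center is `F · 1`. -/
def IsCentral (bar : A →ₗ[F] A) : Prop :=
  center bar = Set.range fun r : F => r • (1 : A)

/-- The ideals of `(A, bar)`: the two-sided ideals that are stable under the involution. -/
structure IsIdeal (bar : A →ₗ[F] A) (I : Submodule F A) : Prop where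
  mul_mem_right : ∀ x ∈ I, ∀ a : A, x * a ∈ I
  mul_mem_left : ∀ x ∈ I, ∀ a : A, a * x ∈ I
  map_bar : I.map bar = I

/-- `(A, bar)` is simple: it is non-zero and has no ideals except `0` and `A`. -/
structure IsSimple (bar : A →ₗ[F] A) : Prop where
  nontrivial : Nontrivial A
  eq_bot_or_eq_top : ∀ I : Submodule F A, IsIdeal bar I → I = ⊥ ∨ I = ⊤

end

end Structurable

/-! ### Hermitian cubic norm structures -/

/-- A hermitian (non-unital) cubic norm structure `(J, N, ♯, T)` over `K/F`, where `σ` is the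
non-trivial automorphism of the quadratic étale extension `K/F`.
The form `T` is `K`-linear in the first and `σ`-semilinear in the second variable. The map
`a × b := (a + b)♯ - a♯ - b♯` is `σ`-semilinear in both variables; since it is symmetric, it is
enough to say so for the first one. -/
structure HermitianCubicNormStructure {F K : Type*} [Field F] [CommRing K] [Algebra F K]
    (σ : K ≃ₐ[F] K) (J : Type*) [AddCommGroup J] [Module K J] where
  /-- the norm -/
  N : J → K
  /-- the adjoint -/
  sharp : J → J
  /-- the trace -/
  T : J →ₗ[K] J →ₛₗ[(σ : K →+* K)] K
  T_conj : ∀ a b : J, σ (T a b) = T b a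
  N_ne_zero : N ≠ 0
  sharp_smul : ∀ (t : K) (a : J), sharp (t • a) = (σ t) ^ 2 • sharp a
  N_smul : ∀ (t : K) (a : J), N (t • a) = t ^ 3 * N a
  N_add : ∀ a b : J, N (a + b) = N a + T b (sharp a) + T a (sharp b) + N b
  sharp_sharp : ∀ a : J, sharp (sharp a) = N a • a
  cross_add : ∀ a b c : J,
    sharp (a + b + c) - sharp (a + b) - sharp c =
      (sharp (a + c) - sharp a - sharp c) + (sharp (b + c) - sharp b - sharp c)
  cross_smul : ∀ (t : K) (a b : J),
    sharp (t • a + b) - sharp (t • a) - sharp b = σ t • (sharp (a + b) - sharp a - sharp b)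

namespace HermitianCubicNormStructure

section

variable {F K J : Type*} [Field F] [CommRing K] [Algebra F K] {σ : K ≃ₐ[F] K}
  [AddCommGroup J] [Module K J] (𝒦 : HermitianCubicNormStructure σ J)

/-- `a × b := (a + b)♯ - a♯ - b♯`. -/
def cross (a b : J) : J := 𝒦.sharp (a + b) - 𝒦.sharp a - 𝒦.sharp b

theorem cross_comm (a b : J) : 𝒦.cross a b = 𝒦.cross b a := by
  unfold cross
  rw [add_comm a b]
  abel

theorem add_cross (a b c : J) : 𝒦.cross (a + b) c = 𝒦.cross a c + 𝒦.cross b c :=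
  𝒦.cross_add a b c

theorem cross_add' (a b c : J) : 𝒦.cross a (b + c) = 𝒦.cross a b + 𝒦.cross a c := by
  rw [cross_comm, add_cross, cross_comm 𝒦 b, cross_comm 𝒦 c]

theorem smul_cross (t : K) (a b : J) : 𝒦.cross (t • a) b = σ t • 𝒦.cross a b :=
  𝒦.cross_smul t a b

theorem cross_smul' (t : K) (a b : J) : 𝒦.cross a (t • b) = σ t • 𝒦.cross a b := by
  rw [cross_comm, smul_cross, cross_comm]

theorem zero_cross (a : J) : 𝒦.cross 0 a = 0 := by
  simpa using 𝒦.smul_cross 0 0 a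

theorem cross_zero (a : J) : 𝒦.cross a 0 = 0 := by
  rw [cross_comm, zero_cross]

/-- The underlying space `K ⊕ J` of the algebra `𝒜(𝒦)`. -/
@[ext]
structure Alg (𝒦 : HermitianCubicNormStructure σ J) where
  fst : K
  snd : J

end

namespace Alg

section

variable {F K J : Type*} [Field F] [CommRing K] [Algebra F K] {σ : K ≃ₐ[F] K}
  [AddCommGroup J] [Module K J] {𝒦 : HermitianCubicNormStructure σ J}

/-- `𝒜(𝒦)` is `K × J`. -/
def equivProd (𝒦 : HermitianCubicNormStructure σ J) : Alg 𝒦 ≃ K × J where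
  toFun x := (x.fst, x.snd)
  invFun p := ⟨p.1, p.2⟩
  left_inv _ := rfl
  right_inv _ := rfl

instance : AddCommGroup (Alg 𝒦) := (equivProd 𝒦).addCommGroup

@[simp] theorem fst_add (x y : Alg 𝒦) : (x + y).fst = x.fst + y.fst := rfl

@[simp] theorem snd_add (x y : Alg 𝒦) : (x + y).snd = x.snd + y.snd := rfl

@[simp] theorem fst_zero : (0 : Alg 𝒦).fst = 0 := rfl

@[simp] theorem snd_zero : (0 : Alg 𝒦).snd = 0 := rfl

/-- `1 = (1, 0)`. -/
instance : One (Alg 𝒦) := ⟨⟨1, 0⟩⟩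

@[simp] theorem fst_one : (1 : Alg 𝒦).fst = 1 := rfl

@[simp] theorem snd_one : (1 : Alg 𝒦).snd = 0 := rfl

/-- `(s, b) (t, c) = (s t + T(b, c), s c + t^σ b + b × c)`. -/
instance : Mul (Alg 𝒦) :=
  ⟨fun x y => ⟨x.fst * y.fst + 𝒦.T x.snd y.snd,
    x.fst • y.snd + σ y.fst • x.snd + 𝒦.cross x.snd y.snd⟩⟩

@[simp] theorem fst_mul (x y : Alg 𝒦) :
    (x * y).fst = x.fst * y.fst + 𝒦.T x.snd y.snd := rfl

@[simp] theorem snd_mul (x y : Alg 𝒦) :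
    (x * y).snd = x.fst • y.snd + σ y.fst • x.snd + 𝒦.cross x.snd y.snd := rfl

instance : NonAssocRing (Alg 𝒦) where
  left_distrib x y z := by
    ext
    · simp only [fst_mul, fst_add, snd_add, map_add]; ring
    · simp only [snd_mul, fst_add, snd_add, map_add, smul_add, add_smul, cross_add']; abel
  right_distrib x y z := by
    ext
    · simp only [fst_mul, fst_add, snd_add, map_add, LinearMap.add_apply]; ring
    · simp only [snd_mul, fst_add, snd_add, smul_add, add_smul, add_cross]; abel
  zero_mul x := by ext <;> simp [zero_cross]
  mul_zero x := by ext <;> simp [cross_zero]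
  one_mul x := by ext <;> simp [zero_cross]
  mul_one x := by ext <;> simp [cross_zero]

variable [Module F J]

/-- The `F`-vector space structure on `K ⊕ J`. -/
instance : Module F (Alg 𝒦) := (equivProd 𝒦).module F

@[simp] theorem fst_smul (r : F) (x : Alg 𝒦) : (r • x).fst = r • x.fst := rfl

@[simp] theorem snd_smul (r : F) (x : Alg 𝒦) : (r • x).snd = r • x.snd := rfl

variable [IsScalarTower F K J]

instance : IsScalarTower F (Alg 𝒦) (Alg 𝒦) where
  smul_assoc r x y := by
    simp only [smul_eq_mul]
    ext
    · simp only [fst_mul, fst_smul, snd_smul, ← algebraMap_smul K r x.snd, map_smul,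
        LinearMap.smul_apply, smul_eq_mul, Algebra.smul_def, mul_assoc, mul_add]
    · simp only [snd_mul, fst_smul, snd_smul, ← algebraMap_smul K r, smul_add, smul_cross,
        smul_smul, smul_eq_mul, AlgEquiv.commutes, mul_comm]

instance : SMulCommClass F (Alg 𝒦) (Alg 𝒦) where
  smul_comm r x y := by
    simp only [smul_eq_mul]
    ext
    · simp only [fst_mul, fst_smul, snd_smul, ← algebraMap_smul K r y.snd, map_smulₛₗ,
        RingHom.coe_coe, AlgEquiv.commutes, smul_eq_mul, Algebra.smul_def, mul_add,
        mul_left_comm]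
    · simp only [snd_mul, fst_smul, snd_smul, ← algebraMap_smul K r, smul_add, cross_smul',
        smul_smul, smul_eq_mul, map_mul, AlgEquiv.commutes, mul_comm]

/-- The involution `(s, b) ↦ (s^σ, b)` of `𝒜(𝒦)`. -/
def conj (𝒦 : HermitianCubicNormStructure σ J) : Alg 𝒦 →ₗ[F] Alg 𝒦 where
  toFun x := ⟨σ x.fst, x.snd⟩
  map_add' x y := by ext <;> simp
  map_smul' r x := by ext <;> simp

end

end Alg

end HermitianCubicNormStructure

/-! Write K = F ⊕ Fk with k skew and k² = μ ∈ F nonzero. The skew form `psi` becomes F-valued after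
multiplication by k, and with the symmetric product `tri` it makes 𝒜 a Freudenthal triple system
(`isFreudenthalTripleSystem`). In such a system the operators S_{x,y} = `der x y` are derivations
(`der_tri`) and are skew for the form (`form_der`), so they satisfy the commutator rule `der_der`.
Since 2V_{x,ky} = S_{x,y} + φ(y,x)·id (`two_smul_V`) and every element has the form ky, this rule
becomes the structurable identity (`bracket_V`).

The triple system axiom needs two adjoint identities. The first, a♯ × (a × b) = N(a)b + T(b,a♯)a, is
a coefficient of a♯♯ = N(a)a. The second, a × (a♯ × b) = σ(N(a))b + T(b,a)a♯, would follow by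
duality if T were non-degenerate. In general it is transported from an element u of invertible norm,
for which u × · is surjective (`cross_sharp_cross`).

Centrality and simplicity come from multiplying by (k,0), which commutes with K and anticommutes
with J. -/

/-! ### Freudenthal triple systems -/

/-- A Freudenthal triple system: a symmetric triple product `tri` and an alternating form `φ` such
that `φ(w, [x, y, z])` is symmetric and `[[x, x, x], x, y] = φ(y, x) [x, x, x] + φ(y, [x, x, x]) x`. -/
structure IsFreudenthalTripleSystem {F M : Type*} [Field F] [AddCommGroup M] [Module F M]
    (tri : M → M → M → M) (φ : M → M → F) : Prop where
  tri_swap : ∀ x y z, tri x y z = tri y x z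
  tri_comm : ∀ x y z, tri x y z = tri x z y
  add_tri : ∀ x x' y z, tri (x + x') y z = tri x y z + tri x' y z
  smul_tri : ∀ (r : F) x y z, tri (r • x) y z = r • tri x y z
  form_swap : ∀ x y, φ x y = -φ y x
  add_form : ∀ x x' y, φ (x + x') y = φ x y + φ x' y
  smul_form : ∀ (r : F) x y, φ (r • x) y = r * φ x y
  form_tri : ∀ w x y z, φ w (tri x y z) = φ x (tri w y z)
  tri_cube : ∀ x y, tri (tri x x x) x y = φ y x • tri x x x + φ y (tri x x x) • x

namespace IsFreudenthalTripleSystem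

variable {F M : Type*} [Field F] [AddCommGroup M] [Module F M] {tri : M → M → M → M}
  {φ : M → M → F} (h : IsFreudenthalTripleSystem tri φ)

include h

theorem tri_add (x y z z' : M) : tri x y (z + z') = tri x y z + tri x y z' := by
  rw [h.tri_comm, h.tri_swap, h.add_tri, h.tri_swap, h.tri_comm, h.tri_swap z', h.tri_comm x z']

theorem tri_smul (r : F) (x y z : M) : tri x y (r • z) = r • tri x y z := by
  rw [h.tri_comm, h.tri_swap, h.smul_tri, h.tri_swap, h.tri_comm]

theorem tri_add_mid (x y y' z : M) : tri x (y + y') z = tri x y z + tri x y' z := by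
  rw [h.tri_swap, h.add_tri, h.tri_swap, h.tri_swap y']

theorem tri_smul_mid (r : F) (x y z : M) : tri x (r • y) z = r • tri x y z := by
  rw [h.tri_swap, h.smul_tri, h.tri_swap]

theorem form_add (x y y' : M) : φ x (y + y') = φ x y + φ x y' := by
  rw [h.form_swap, h.add_form, h.form_swap x y, h.form_swap x y']; ring

theorem form_smul (r : F) (x y : M) : φ x (r • y) = r * φ x y := by
  rw [h.form_swap, h.smul_form, h.form_swap x y]; ring

theorem form_self (h2 : (2 : F) ≠ 0) (x : M) : φ x x = 0 := by
  have := h.form_swap x x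
  have : 2 * φ x x = 0 := by linear_combination this
  simpa [h2] using this

/-- The expansion of the axiom `tri_cube` at `x + t z`. -/
theorem tri_cube_add_smul (t : F) (x z y : M) :
    t • (3 • tri (tri x x z) x y + tri (tri x x x) z y
        - (φ y z • tri x x x + (3 * φ y x) • tri x x z + (3 * φ y (tri x x z)) • x
          + φ y (tri x x x) • z))
      + t ^ 2 • (3 • tri (tri x z z) x y + 3 • tri (tri x x z) z y
        - ((3 * φ y x) • tri x z z + (3 * φ y z) • tri x x z + (3 * φ y (tri x z z)) • x
          + (3 * φ y (tri x x z)) • z))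
      + t ^ 3 • (3 • tri (tri x z z) z y + tri (tri z z z) x y
        - (φ y x • tri z z z + (3 * φ y z) • tri x z z + (3 * φ y (tri x z z)) • z
          + φ y (tri z z z) • x)) = 0 := by
  have h0 := h.tri_cube (x + t • z) y
  have h1 := h.tri_cube x y
  have h4 := h.tri_cube z y
  simp only [h.add_tri, h.tri_add, h.tri_add_mid, h.smul_tri, h.tri_smul, h.tri_smul_mid,
    h.form_add, h.form_smul] at h0
  rw [h.tri_comm x z x, h.tri_swap z x x, h.tri_comm x z x, h.tri_swap z x z,
    h.tri_comm z z x, h.tri_swap z x z] at h0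
  -- The coefficients of t⁰ and t⁴ are the axiom at x and at z.
  linear_combination (norm := module) h0 - h1 - t ^ 4 • h4

/-- The symplectic derivation `S_{x, y}`. -/
def der (_ : IsFreudenthalTripleSystem tri φ) (x y z : M) : M :=
  tri x y z + φ y z • x + φ x z • y

/-- The terms [[x,z,z],x,z] occur in two coefficients of the expanded axiom: the linear one with
base z, direction x and last argument x, and the quadratic one with base x, direction z and last
argument z. Subtracting cancels them and leaves the derivation rule on cubes. -/
theorem tri_cube_right (h2 : (2 : F) ≠ 0) (h3 : (3 : F) ≠ 0) (x z : M) :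
    h.der x x (tri z z z) = 3 • tri (h.der x x z) z z := by
  have e1 := h.tri_cube_add_smul 1 x z z
  have e2 := h.tri_cube_add_smul (-1) x z z
  have e3 := h.tri_cube_add_smul 1 z x x
  have e4 := h.tri_cube_add_smul (-1) z x x
  have e5 := h.tri_cube_add_smul 2 z x x
  simp only [h.tri_comm z z x, h.tri_swap z x z, h.tri_swap z x x, h.tri_comm x z x,
    h.tri_comm _ z x, h.form_swap z x, h.form_self h2] at e1 e2 e3 e4 e5
  have f1 : φ x (tri x z z) = φ z (tri x x z) := by rw [h.tri_swap, h.form_tri]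
  have f2 : φ x (tri z z z) = φ z (tri x z z) := h.form_tri ..
  rw [f1, f2] at e3 e4 e5
  simp only [der, h.add_tri, h.smul_tri]
  rw [h.tri_comm x x (tri z z z), h.tri_swap x (tri z z z), f2]
  have h6 : (6 : F) ≠ 0 := by
    rw [show (6 : F) = 2 * 3 by norm_num]; exact mul_ne_zero h2 h3
  apply smul_right_injective M h6
  simp only
  -- The weights 6, -2, -1 at t = 1, -1, 2 isolate six times the linear coefficient; `e1 + e2` is
  -- twice the quadratic one.
  linear_combination (norm := module) (6 : F) • e3 - (2 : F) • e4 - e5 - (3 : F) • e1 - (3 : F) • e2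

theorem der_add (x y z z' : M) : h.der x y (z + z') = h.der x y z + h.der x y z' := by
  simp only [der, h.tri_add, h.form_add]; module

theorem der_smul (r : F) (x y z : M) : h.der x y (r • z) = r • h.der x y z := by
  simp only [der, h.tri_smul, h.form_smul]; module

theorem der_add_left (x x' y z : M) : h.der (x + x') y z = h.der x y z + h.der x' y z := by
  simp only [der, h.add_tri, h.add_form]; module

theorem der_smul_left (r : F) (x y z : M) : h.der (r • x) y z = r • h.der x y z := by
  simp only [der, h.smul_tri, h.smul_form]; module

theorem der_add_mid (x y y' z : M) : h.der x (y + y') z = h.der x y z + h.der x y' z := by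
  simp only [der, h.tri_add_mid, h.add_form]; module

theorem der_smul_mid (r : F) (x y z : M) : h.der x (r • y) z = r • h.der x y z := by
  simp only [der, h.tri_smul_mid, h.smul_form]; module

/-- `S_{x, x}` is a derivation of the triple product. -/
theorem der_self_tri (h2 : (2 : F) ≠ 0) (h3 : (3 : F) ≠ 0) (x z w v : M) :
    h.der x x (tri z w v) =
      tri (h.der x x z) w v + tri z (h.der x x w) v + tri z w (h.der x x v) := by
  -- Full polarisation of the cubic rule in its second variable, which yields six times the claim.
  have e1 := h.tri_cube_right h2 h3 x (z + w + v)
  have e2 := h.tri_cube_right h2 h3 x (z + w)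
  have e3 := h.tri_cube_right h2 h3 x (z + v)
  have e4 := h.tri_cube_right h2 h3 x (w + v)
  have e5 := h.tri_cube_right h2 h3 x z
  have e6 := h.tri_cube_right h2 h3 x w
  have e7 := h.tri_cube_right h2 h3 x v
  have h6 : (6 : F) ≠ 0 := by
    rw [show (6 : F) = 2 * 3 by norm_num]; exact mul_ne_zero h2 h3
  apply smul_right_injective M h6
  simp only [h.add_tri, h.tri_add, h.tri_add_mid, h.der_add] at e1 e2 e3 e4
  simp only [h.tri_comm, h.tri_swap] at e1 e2 e3 e4 e5 e6 e7 ⊢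
  linear_combination (norm := module) e1 - e2 - e3 - e4 + e5 + e6 + e7

/-- `S_{x, y}` is a derivation of the triple product. -/
theorem der_tri (h2 : (2 : F) ≠ 0) (h3 : (3 : F) ≠ 0) (x y z w v : M) :
    h.der x y (tri z w v) =
      tri (h.der x y z) w v + tri z (h.der x y w) v + tri z w (h.der x y v) := by
  have key (u : M) : (2 : F) • h.der x y u = h.der (x + y) (x + y) u - h.der x x u - h.der y y u := by
    simp only [der, h.add_tri, h.tri_add_mid, h.add_form, h.tri_swap y x]
    module
  apply smul_right_injective M h2
  simp only
  have e1 := h.der_self_tri h2 h3 (x + y) z w v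
  have e2 := h.der_self_tri h2 h3 x z w v
  have e3 := h.der_self_tri h2 h3 y z w v
  rw [smul_add, smul_add, ← h.smul_tri, ← h.tri_smul_mid 2 z (h.der x y w),
    ← h.tri_smul 2 z w, key, key, key, key]
  simp only [sub_eq_add_neg, ← neg_one_smul F (h.der _ _ _), h.add_tri, h.tri_add, h.tri_add_mid, h.smul_tri,
    h.tri_smul, h.tri_smul_mid]
  linear_combination (norm := module) e1 - e2 - e3

theorem form_der (x y z w : M) : φ (h.der x y z) w + φ z (h.der x y w) = 0 := by
  rw [h.form_swap (h.der x y z) w]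
  simp only [der, h.form_add, h.form_smul]
  rw [h.tri_comm x y z, h.tri_swap x z y, h.form_tri w, h.tri_swap w x y, h.tri_comm x w y,
    h.form_swap z x, h.form_swap z y, h.form_swap w x, h.form_swap w y]
  ring

/-- S_{z,w} is built from the triple product and the form, and S_{x,y} acts as a derivation on the
former and is skew for the latter. -/
theorem der_der (h2 : (2 : F) ≠ 0) (h3 : (3 : F) ≠ 0) (x y z w v : M) :
    h.der x y (h.der z w v) - h.der z w (h.der x y v) =
      h.der (h.der x y z) w v + h.der z (h.der x y w) v := by
  have e1 := h.form_der x y z v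
  have e2 := h.form_der x y w v
  have e3 := h.der_tri h2 h3 x y z w v
  rw [add_eq_zero_iff_eq_neg] at e1 e2
  have e (u v w) : h.der u v w = tri u v w + φ v w • u + φ u w • v := rfl
  rw [e z w v, h.der_add, h.der_add, h.der_smul, h.der_smul, e3, e z w (h.der x y v),
    e (h.der x y z) w v, e z (h.der x y w) v, e1, e2]
  module

end IsFreudenthalTripleSystem

/-! ### Adjoint identities in a hermitian cubic norm structure. -/

namespace HermitianCubicNormStructure

section

variable {F K J : Type*} [Field F] [CommRing K] [Algebra F K] {σ : K ≃ₐ[F] K}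
  [AddCommGroup J] [Module K J] (𝒦 : HermitianCubicNormStructure σ J)

theorem sharp_add (a b : J) : 𝒦.sharp (a + b) = 𝒦.sharp a + 𝒦.sharp b + 𝒦.cross a b := by
  unfold cross; abel

theorem cross_self (a : J) : 𝒦.cross a a = (2 : K) • 𝒦.sharp a := by
  have := 𝒦.sharp_smul 2 a
  rw [two_smul, sharp_add, map_ofNat] at this
  linear_combination (norm := module) this

theorem T_smul_left (t : K) (a b : J) : 𝒦.T (t • a) b = t * 𝒦.T a b := by simp

theorem T_smul_right (t : K) (a b : J) : 𝒦.T a (t • b) = σ t * 𝒦.T a b := by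
  rw [map_smulₛₗ]; rfl

theorem T_add_left (a a' b : J) : 𝒦.T (a + a') b = 𝒦.T a b + 𝒦.T a' b := by simp

theorem T_add_right (a b b' : J) : 𝒦.T a (b + b') = 𝒦.T a b + 𝒦.T a b' := by simp

/-- The trilinear form `T(a, b × c)` is symmetric. -/
theorem T_cross_rotate (a b c : J) : 𝒦.T a (𝒦.cross b c) = 𝒦.T c (𝒦.cross a b) := by
  -- Compare the expansions of N((a + b) + c) and N(a + (b + c)).
  have e1 := 𝒦.N_add (a + b) c
  have e2 := 𝒦.N_add a (b + c)
  rw [← add_assoc] at e2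
  simp only [𝒦.N_add a b, 𝒦.N_add b c, sharp_add, T_add_left, T_add_right] at e1 e2
  linear_combination e1 - e2

theorem T_cross_swap (a b c : J) : 𝒦.T a (𝒦.cross b c) = 𝒦.T b (𝒦.cross a c) := by
  rw [T_cross_rotate, T_cross_rotate, cross_comm]

theorem T_sharp_self (h2 : IsUnit (2 : K)) (a : J) : 𝒦.T a (𝒦.sharp a) = 3 * 𝒦.N a := by
  have e1 := 𝒦.N_add a a
  rw [← two_smul K, N_smul] at e1
  apply h2.mul_left_cancel
  linear_combination - e1

/-- Expansion of (a + tb)♯♯ = N(a + tb)(a + tb). Taking t fixed by σ makes both sides polynomial in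
t; the extreme coefficients are the axiom at a and at b. -/
theorem sharp_sharp_add_smul (t : K) (ht : σ t = t) (a b : J) :
    t • (𝒦.cross (𝒦.sharp a) (𝒦.cross a b) - 𝒦.N a • b - 𝒦.T b (𝒦.sharp a) • a)
      + t ^ 2 • (𝒦.sharp (𝒦.cross a b) + 𝒦.cross (𝒦.sharp a) (𝒦.sharp b)
        - 𝒦.T b (𝒦.sharp a) • b - 𝒦.T a (𝒦.sharp b) • a)
      + t ^ 3 • (𝒦.cross (𝒦.cross a b) (𝒦.sharp b) - 𝒦.N b • a - 𝒦.T a (𝒦.sharp b) • b) = 0 := by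
  have e := 𝒦.sharp_sharp (a + t • b)
  simp only [sharp_add, sharp_smul, cross_smul', N_add, N_smul, T_smul_left, T_smul_right, map_pow,
    ht, add_cross, smul_cross, sharp_sharp] at e
  rw [cross_comm 𝒦 (𝒦.sharp b)] at e
  linear_combination (norm := module) e

theorem sharp_cross_cross (h2 : IsUnit (2 : K)) (h3 : IsUnit (3 : K)) (a b : J) :
    𝒦.cross (𝒦.sharp a) (𝒦.cross a b) = 𝒦.N a • b + 𝒦.T b (𝒦.sharp a) • a := by
  have e1 := 𝒦.sharp_sharp_add_smul 1 (map_one σ) a b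
  have e2 := 𝒦.sharp_sharp_add_smul (-1) (by simp) a b
  have e3 := 𝒦.sharp_sharp_add_smul 2 (map_ofNat σ 2) a b
  apply h2.smul_left_cancel.1
  apply h3.smul_left_cancel.1
  -- This combination of t = 1, -1, 2 kills t² and t³ and leaves six times the linear coefficient.
  linear_combination (norm := module) (6 : K) • e1 - (2 : K) • e2 - e3

theorem sharp_cross_cross_linear (h2 : IsUnit (2 : K)) (h3 : IsUnit (3 : K)) (a c b : J) :
    𝒦.cross (𝒦.cross a c) (𝒦.cross a b) + 𝒦.cross (𝒦.sharp a) (𝒦.cross c b) =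
      𝒦.T c (𝒦.sharp a) • b + 𝒦.T b (𝒦.cross a c) • a + 𝒦.T b (𝒦.sharp a) • c := by
  have key (t : K) (ht : σ t = t) := 𝒦.sharp_cross_cross h2 h3 (a + t • c) b
  have e0 := 𝒦.sharp_cross_cross h2 h3 a b
  have e0' := 𝒦.sharp_cross_cross h2 h3 c b
  have e1 := key 1 (map_one σ)
  have e2 := key (-1) (by simp)
  simp only [sharp_add, sharp_smul, cross_smul', N_add, N_smul, T_smul_left, T_smul_right, map_pow,
    map_one, map_neg, add_cross, cross_add', smul_cross, T_add_right] at e1 e2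
  apply h2.smul_left_cancel.1
  linear_combination (norm := module) e1 - e2 - (2 : K) • e0'

theorem N_sharp (h2 : IsUnit (2 : K)) (h3 : IsUnit (3 : K)) (a : J) :
    𝒦.N (𝒦.sharp a) = σ (𝒦.N a) ^ 2 := by
  have e := 𝒦.T_sharp_self h2 (𝒦.sharp a)
  apply h3.mul_left_cancel
  rw [← e, sharp_sharp, T_smul_right, ← T_conj, T_sharp_self 𝒦 h2, map_mul, map_ofNat]
  ring

/-- The first adjoint identity at u♯, where u♯♯ = N(u)u, is σ(N(u)) times the claim, and that factor
can be cancelled. -/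
theorem cross_sharp_cross_of_isUnit (h2 : IsUnit (2 : K)) (h3 : IsUnit (3 : K)) {u : J}
    (hu : IsUnit (𝒦.N u)) (b : J) :
    𝒦.cross u (𝒦.cross (𝒦.sharp u) b) = σ (𝒦.N u) • b + 𝒦.T b u • 𝒦.sharp u := by
  have e := 𝒦.sharp_cross_cross h2 h3 (𝒦.sharp u) b
  rw [sharp_sharp, 𝒦.N_sharp h2 h3, smul_cross, T_smul_right] at e
  apply (hu.map σ).smul_left_cancel.1
  rw [e]
  module

/-- Because u × u = 2u♯, the term T(b,u)u♯ in the second adjoint identity is itself in the image of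
u × ·, hence so is b. -/
theorem exists_cross_eq_of_isUnit (h2 : IsUnit (2 : K)) (h3 : IsUnit (3 : K)) {u : J}
    (hu : IsUnit (𝒦.N u)) (b : J) : ∃ s, 𝒦.cross u s = b := by
  obtain ⟨n, hn⟩ := hu.map σ
  obtain ⟨m, hm⟩ := σ.surjective ((n⁻¹ : Kˣ) : K)
  have e := 𝒦.cross_sharp_cross_of_isUnit h2 h3 hu b
  obtain ⟨c, hc⟩ := h2.exists_left_inv
  obtain ⟨l, hl⟩ := σ.surjective (𝒦.T b u * c)
  refine ⟨m • (𝒦.cross (𝒦.sharp u) b - l • u), ?_⟩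
  rw [cross_smul', hm, sub_eq_add_neg, ← neg_smul, cross_add', e, cross_smul', map_neg, hl,
    cross_self, ← hn]
  rw [show (n : K) • b + 𝒦.T b u • 𝒦.sharp u +
    -(𝒦.T b u * c) • (2 : K) • 𝒦.sharp u = (n : K) • b +
      (𝒦.T b u * (1 - c * 2)) • 𝒦.sharp u by module, hc, sub_self, mul_zero,
    zero_smul, add_zero, smul_smul, Units.inv_mul, one_smul]

/-- Choose s, p, m with b = u × s, a × s = u × p and a × p = u × m. Linearised first identities,
multiplied by a, reduce a × (a♯ × b) to σ(N(u))(a × m). This equals u × (u♯ × (a × m)) up to a trace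
term, and the same identities multiplied by u lead on to u × (a♯ × (a × s)), which is u × (N(a)s +
T(s,a♯)a). -/
theorem cross_sharp_cross_of_exists_isUnit (h2 : IsUnit (2 : K)) (h3 : IsUnit (3 : K)) {u : J} (hu : IsUnit (𝒦.N u)) (a b : J) :
    𝒦.cross a (𝒦.cross (𝒦.sharp a) b) = σ (𝒦.N a) • b + 𝒦.T b a • 𝒦.sharp a := by
  obtain ⟨s, rfl⟩ := 𝒦.exists_cross_eq_of_isUnit h2 h3 hu b
  obtain ⟨p, hp⟩ := 𝒦.exists_cross_eq_of_isUnit h2 h3 hu (𝒦.cross a s)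
  obtain ⟨m, hm⟩ := 𝒦.exists_cross_eq_of_isUnit h2 h3 hu (𝒦.cross a p)
  have e1 := 𝒦.sharp_cross_cross_linear h2 h3 a u s
  have e2 := 𝒦.sharp_cross_cross_linear h2 h3 u a p
  have e3 := 𝒦.sharp_cross_cross h2 h3 u m
  rw [← hp] at e1
  rw [cross_comm 𝒦 u a] at e2
  rw [hm] at e3
  have c1 := congrArg (𝒦.cross a) e1
  have c2 := congrArg (𝒦.cross a) e2
  have c3 := congrArg (𝒦.cross a) e3
  have e4 := 𝒦.sharp_cross_cross h2 h3 a s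
  have e5 := 𝒦.sharp_cross_cross_linear h2 h3 a u p
  have e6 := 𝒦.sharp_cross_cross_linear h2 h3 u a m
  have e7 := 𝒦.cross_sharp_cross_of_isUnit h2 h3 hu (𝒦.cross a m)
  rw [← hp] at e4
  rw [← hm] at e5
  rw [cross_comm 𝒦 u a] at e6
  have c4 := congrArg (𝒦.cross u) e4
  have c5 := congrArg (𝒦.cross u) e5
  have c6 := congrArg (𝒦.cross u) e6
  simp only [cross_add', cross_smul', cross_self, hp, hm, 𝒦.cross_comm u a] at c1 c2 c3 c4 c5 c6 e7
  -- The relations defining s, p, m also link the trace coefficients, through the symmetry of T(x, y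
  -- × z).
  have t0 : 𝒦.T (𝒦.cross u s) a = σ (𝒦.T s (𝒦.cross a u)) := by
    rw [← T_conj, 𝒦.cross_comm u s, T_cross_swap, 𝒦.cross_comm a u]
  have t1 : 𝒦.T p (𝒦.cross a u) = 2 * 𝒦.T s (𝒦.sharp a) := by
    rw [T_cross_swap, 𝒦.cross_comm p u, hp, 𝒦.cross_comm a s, T_cross_swap, cross_self,
      T_smul_right, map_ofNat]
  have t2 : 𝒦.T m (𝒦.sharp u) = 𝒦.T s (𝒦.sharp a) := by
    apply h2.mul_left_cancel
    rw [← t1, ← map_ofNat σ 2, ← T_smul_right, ← cross_self, T_cross_swap, 𝒦.cross_comm m u, hm,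
      𝒦.cross_comm a p, T_cross_swap, 𝒦.cross_comm u a]
  have t3 : 𝒦.T m (𝒦.cross a u) = 2 * 𝒦.T p (𝒦.sharp a) := by
    rw [T_cross_swap, 𝒦.cross_comm m u, hm, 𝒦.cross_comm a p, T_cross_swap, cross_self,
      T_smul_right, map_ofNat]
  have t4 : 𝒦.T s (𝒦.cross a u) = 2 * 𝒦.T p (𝒦.sharp u) := by
    rw [𝒦.cross_comm a u, T_cross_swap, 𝒦.cross_comm s a, ← hp, 𝒦.cross_comm u p, T_cross_swap,
      cross_self, T_smul_right, map_ofNat]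
  have t5 : 𝒦.T (𝒦.cross a m) u = σ (𝒦.T m (𝒦.cross a u)) := by
    rw [← T_conj, T_cross_swap, 𝒦.cross_comm u m, T_cross_swap]
  rw [t5] at e7
  rw [t0]
  simp only [t1, t2, t3, t4, map_mul, map_ofNat] at c1 c2 c3 c4 c5 c6 e7 ⊢
  linear_combination (norm := module) c1 - c2 + c3 + c4 - c5 + c6 - e7

end

end HermitianCubicNormStructure

/-! ### Quadratic étale extensions -/

/-- Complete the square for any θ outside F. Étale algebras are reduced, so μ ≠ 0. Squaring σ(k) = b
+ dk forces b = 0 and d = ±1, and d = 1 would make σ trivial. -/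
theorem exists_skew_generator {F K : Type*} [Field F] (h2 : (2 : F) ≠ 0) [CommRing K] [Algebra F K]
    [Algebra.IsQuadraticExtension F K] [Algebra.Etale F K] (σ : K ≃ₐ[F] K)
    (hσ : σ ≠ AlgEquiv.refl) :
    ∃ (k : K) (μ : F), μ ≠ 0 ∧ k * k = algebraMap F K μ ∧ σ k = -k ∧
      ∀ z : K, ∃ α β : F, z = algebraMap F K α + algebraMap F K β * k := by
  have hd : Module.finrank F K = 2 := Algebra.IsQuadraticExtension.finrank_eq_two F K
  have : Nontrivial K := Module.nontrivial_of_finrank_pos (R := F) (by omega)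
  have hred : IsReduced K := Algebra.FormallyUnramified.isReduced_of_field F K
  have hinj : Function.Injective (algebraMap F K) := (algebraMap F K).injective
  obtain ⟨θ, hθ⟩ : ∃ θ : K, ∀ r : F, algebraMap F K r ≠ θ := by
    by_contra! hc
    refine hσ (AlgEquiv.ext fun z => ?_)
    obtain ⟨r, rfl⟩ := hc z
    simp
  have span_of (θ : K) (hθ : ∀ r : F, algebraMap F K r ≠ θ) (z : K) :
      ∃ α β : F, z = algebraMap F K α + algebraMap F K β * θ := by
    have hli : LinearIndependent F ![(1 : K), θ] := by
      rw [LinearIndependent.pair_iff' one_ne_zero]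
      intro r
      simpa [Algebra.smul_def] using hθ r
    let b := basisOfLinearIndependentOfCardEqFinrank hli (by simp [hd])
    refine ⟨b.repr z 0, b.repr z 1, ?_⟩
    conv_lhs => rw [← b.sum_repr z]
    simp [b, Algebra.smul_def]
  obtain ⟨n, t, ht⟩ := span_of θ hθ (θ * θ)
  set k := θ - algebraMap F K (t / 2) with hk
  have hkF (r : F) : algebraMap F K r ≠ k := fun h => hθ (r + t / 2) (by rw [map_add, h, hk]; ring)
  have htt : algebraMap F K t = 2 * algebraMap F K (t / 2) := by
    rw [← map_ofNat (algebraMap F K) 2, ← map_mul, mul_div_cancel₀ _ h2]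
  have hkk : k * k = algebraMap F K (n + (t / 2) ^ 2) := by
    rw [map_add, map_pow]
    linear_combination ht + htt * θ
  have hμ : n + (t / 2) ^ 2 ≠ 0 := by
    intro h0
    rw [h0, map_zero] at hkk
    have : k = 0 := (pow_eq_zero_iff two_ne_zero).1 (by rw [sq, hkk])
    exact hkF 0 (by rw [this, map_zero])
  generalize n + (t / 2) ^ 2 = μ at hkk hμ
  refine ⟨k, μ, hμ, hkk, ?_, span_of k hkF⟩
  obtain ⟨b, d, hbd⟩ := span_of k hkF (σ k)
  have e := congrArg σ hkk
  have e' : algebraMap F K (2 * b * d) * k = algebraMap F K (μ - b ^ 2 - d ^ 2 * μ) := by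
    rw [map_mul, hbd, AlgEquiv.commutes] at e
    simp only [map_mul, map_sub, map_pow, map_ofNat]
    linear_combination e - algebraMap F K d ^ 2 * hkk
  have hbd0 : 2 * b * d = 0 := by
    by_contra h0
    refine hkF ((2 * b * d)⁻¹ * (μ - b ^ 2 - d ^ 2 * μ)) ?_
    rw [map_mul, ← e', ← mul_assoc, ← map_mul, inv_mul_cancel₀ h0, map_one, one_mul]
  have hd0 : d ≠ 0 := by
    rintro rfl
    refine hkF b (σ.injective ?_)
    simpa using hbd.symm
  have hb : b = 0 := by simpa [h2, hd0] using hbd0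
  subst hb
  have hd2 : d ^ 2 = 1 := by
    rw [hbd0, map_zero, zero_mul, eq_comm, ← map_zero (algebraMap F K)] at e'
    have := hinj e'
    apply mul_right_cancel₀ hμ
    linear_combination -this
  rcases mul_self_eq_one_iff.1 ((sq d).symm.trans hd2) with rfl | rfl
  · refine absurd (AlgEquiv.ext fun z => ?_) hσ
    obtain ⟨α, β, rfl⟩ := span_of k hkF z
    simp [hbd]
  · simpa using hbd

/-! ### Existence of an element of invertible norm. -/

namespace HermitianCubicNormStructure

section

variable {F K J : Type*} [Field F] [CommRing K] [Algebra F K] {σ : K ≃ₐ[F] K}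
  [AddCommGroup J] [Module K J] (𝒦 : HermitianCubicNormStructure σ J)

theorem exists_isUnit_N (h2 : IsUnit (2 : K)) (h3 : IsUnit (3 : K)) (hσ : ∀ t, σ (σ t) = t)
    [IsReduced K] (hK : ∀ z : K, σ z = z → z = 0 ∨ IsUnit z) : ∃ u, IsUnit (𝒦.N u) := by
  obtain ⟨a, ha⟩ : ∃ a, 𝒦.N a ≠ 0 := by
    by_contra! hc
    exact 𝒦.N_ne_zero (funext hc)
  set n := 𝒦.N a with hn
  rcases hK (n * σ n) (by rw [map_mul, hσ, mul_comm]) with h0 | h1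
  swap
  · exact ⟨a, isUnit_of_mul_isUnit_left h1⟩
  rcases hK (n + σ n) (by rw [map_add, hσ, add_comm]) with h0' | h1
  · refine absurd ?_ ha
    have : n ^ 2 = 0 := by linear_combination n * h0' - h0
    simpa using this
  obtain ⟨i, hi⟩ := h1.exists_left_inv
  have hσi : σ i = i := by
    apply h1.mul_left_cancel
    have := congrArg σ hi
    rw [map_mul, map_add, hσ, map_one] at this
    linear_combination this - hi
  have hN : 𝒦.N (𝒦.sharp a) = σ n ^ 2 := 𝒦.N_sharp h2 h3 a
  -- Now nσ(n) = 0 with n + σ(n) invertible, so in and iσ(n) are complementary idempotents. The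
  -- mixed terms vanish and the norm is n + σ(n)², invertible on each of the two factors.
  refine ⟨(i * n) • a + (i * σ n) • 𝒦.sharp a, .of_mul_eq_one (i ^ 2 * n + i ^ 3 * σ n) ?_⟩
  rw [N_add, N_smul, N_smul, sharp_smul, sharp_smul, T_smul_left, T_smul_right, T_smul_left,
    T_smul_right, hN, sharp_sharp, T_smul_right, ← hn]
  simp only [map_mul, map_pow, hσ, hσi]
  generalize σ n = m at *
  have q1 : i * n ^ 2 = n := by linear_combination n * hi - i * h0
  have q2 : i * m ^ 2 = m := by linear_combination m * hi - i * h0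
  have q3 : i ^ 3 * n ^ 4 = n := by linear_combination (i ^ 2 * n ^ 2 + i * n + 1) * q1
  have q4 : i ^ 3 * m ^ 5 = m ^ 2 := by linear_combination (i ^ 2 * m ^ 2 + i * m + 1) * m * q2
  have q5 : i ^ 3 * m ^ 3 = i * m := by linear_combination (i * m + 1) * i * q2
  linear_combination (q3 + q4 + (i ^ 3 * n * 𝒦.T (𝒦.sharp a) (𝒦.sharp a) +
    i ^ 3 * m ^ 2 * 𝒦.T a a) * h0) * (i ^ 2 * n + i ^ 3 * m) + (i ^ 3 + i ^ 2 * m) * h0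
    + i * q1 + q5 + hi

theorem cross_sharp_cross (h2 : IsUnit (2 : K)) (h3 : IsUnit (3 : K)) (hσ : ∀ t, σ (σ t) = t)
    [IsReduced K] (hK : ∀ z : K, σ z = z → z = 0 ∨ IsUnit z) (a b : J) :
    𝒦.cross a (𝒦.cross (𝒦.sharp a) b) = σ (𝒦.N a) • b + 𝒦.T b a • 𝒦.sharp a := by
  obtain ⟨u, hu⟩ := 𝒦.exists_isUnit_N h2 h3 hσ hK
  exact 𝒦.cross_sharp_cross_of_exists_isUnit h2 h3 hu a b

end

end HermitianCubicNormStructure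

/-! ### Identities for the cube of an element of 𝒜(𝒦). -/

namespace HermitianCubicNormStructure

section

variable {F K J : Type*} [Field F] [CommRing K] [Algebra F K] {σ : K ≃ₐ[F] K}
  [AddCommGroup J] [Module K J] (𝒦 : HermitianCubicNormStructure σ J)

theorem T_cross_cross (a b c d : J) :
    𝒦.T a (𝒦.cross (𝒦.cross b c) d) = 𝒦.T (𝒦.cross b c) (𝒦.cross a d) :=
  𝒦.T_cross_swap ..

theorem T_cross_cross' (a b c d : J) :
    𝒦.T (𝒦.cross (𝒦.cross b c) d) a = 𝒦.T (𝒦.cross a d) (𝒦.cross b c) := by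
  rw [← T_conj, T_cross_cross, T_conj]

theorem T_cross_left_swap (a b c : J) : 𝒦.T (𝒦.cross a b) c = 𝒦.T (𝒦.cross c b) a := by
  rw [← T_conj, T_cross_swap, T_conj]

theorem cross_sharp_cross_linear (h2 : IsUnit (2 : K))
    (hE : ∀ a b, 𝒦.cross a (𝒦.cross (𝒦.sharp a) b) = σ (𝒦.N a) • b + 𝒦.T b a • 𝒦.sharp a)
    (a c b : J) :
    𝒦.cross c (𝒦.cross (𝒦.sharp a) b) + 𝒦.cross a (𝒦.cross (𝒦.cross a c) b) =
      σ (𝒦.T c (𝒦.sharp a)) • b + 𝒦.T b c • 𝒦.sharp a + 𝒦.T b a • 𝒦.cross a c := by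
  have e0 := hE c b
  have e1 := hE (a + (1 : K) • c) b
  have e2 := hE (a + (-1 : K) • c) b
  simp only [sharp_add, sharp_smul, cross_smul', N_add, N_smul, T_smul_left, T_smul_right, map_pow,
    map_one, map_neg, map_add, map_mul, add_cross, cross_add', smul_cross] at e1 e2
  apply h2.smul_left_cancel.1
  linear_combination (norm := module) e1 - e2 - (2 : K) • e0

/-- Linearise both adjoint identities in the direction a♯ and subtract: the terms a♯ × (a♯ × d)
cancel. -/
theorem cross_cross_sharp (h2 : IsUnit (2 : K)) (h3 : IsUnit (3 : K))
    (hE : ∀ a b, 𝒦.cross a (𝒦.cross (𝒦.sharp a) b) = σ (𝒦.N a) • b + 𝒦.T b a • 𝒦.sharp a)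
    (a d : J) :
    𝒦.cross (𝒦.cross (𝒦.cross (𝒦.sharp a) a) d) a -
        𝒦.cross (𝒦.cross a d) (𝒦.cross (𝒦.sharp a) a) =
      𝒦.T d a • 𝒦.cross (𝒦.sharp a) a - 𝒦.T d (𝒦.cross (𝒦.sharp a) a) • a := by
  have e1 := 𝒦.cross_sharp_cross_linear h2 hE a (𝒦.sharp a) d
  have e2 := 𝒦.sharp_cross_cross_linear h2 h3 a (𝒦.sharp a) d
  rw [T_conj] at e1
  rw [𝒦.cross_comm a (𝒦.sharp a)] at e1 e2
  rw [𝒦.cross_comm _ a, 𝒦.cross_comm (𝒦.cross a d)]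
  linear_combination (norm := module) e1 - e2

namespace Alg

variable {𝒦}

/-- The first component of a sixth of the cube in the Freudenthal triple system of `𝒜(𝒦)`. -/
def cubeFst (x : Alg 𝒦) : K :=
  -(x.fst * (x.fst * σ x.fst - 𝒦.T x.snd x.snd)) - 2 * σ (𝒦.N x.snd)

/-- The second component of a sixth of the cube in the Freudenthal triple system of `𝒜(𝒦)`. -/
def cubeSnd (x : Alg 𝒦) : J :=
  (x.fst * σ x.fst - 𝒦.T x.snd x.snd) • x.snd - (2 * σ x.fst) • 𝒦.sharp x.snd
    + (2 : K) • 𝒦.cross (𝒦.sharp x.snd) x.snd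

variable (h2 : IsUnit (2 : K)) (h3 : IsUnit (3 : K)) (hσ : ∀ t, σ (σ t) = t)
    (hE : ∀ a b, 𝒦.cross a (𝒦.cross (𝒦.sharp a) b) = σ (𝒦.N a) • b + 𝒦.T b a • 𝒦.sharp a)

-- This identity and the next three express what the axiom on [[x,x,x],x,y] requires of the cube of
-- x, split by components.
include h2 hσ in
theorem T_cubeSnd_sub (x : Alg 𝒦) :
    𝒦.T (cubeSnd x) x.snd - 𝒦.T x.snd (cubeSnd x) =
      6 * (x.fst * 𝒦.N x.snd - σ x.fst * σ (𝒦.N x.snd)) := by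
  obtain ⟨s, a⟩ := x
  simp only [cubeSnd]
  have e1 := 𝒦.T_sharp_self h2 a
  have e2 : 𝒦.T (𝒦.sharp a) a = 3 * σ (𝒦.N a) := by rw [← T_conj, e1, map_mul, map_ofNat]
  have e3 : 𝒦.T a (𝒦.cross (𝒦.sharp a) a) = 2 * 𝒦.T (𝒦.sharp a) (𝒦.sharp a) := by
    rw [T_cross_swap, cross_self, T_smul_right, map_ofNat]
  have e4 : 𝒦.T (𝒦.cross (𝒦.sharp a) a) a = 2 * 𝒦.T (𝒦.sharp a) (𝒦.sharp a) := by
    rw [T_cross_left_swap, cross_self, T_smul_left]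
  simp only [sub_eq_add_neg, ← neg_smul, T_add_left, T_add_right, T_smul_left, T_smul_right, e1, e2,
    e3, e4, map_neg σ, map_add σ, map_mul, map_ofNat, hσ, T_conj]
  ring

include hσ hE in
theorem cubeFst_mul_T (x : Alg 𝒦) (d : J) :
    cubeFst x * 𝒦.T x.snd d + x.fst * 𝒦.T (cubeSnd x) d + 𝒦.T (𝒦.cross x.snd d) (cubeSnd x) = 0 := by
  obtain ⟨s, a⟩ := x
  simp only [cubeSnd, cubeFst]
  have e1 : 𝒦.T (𝒦.cross a d) a = 2 * 𝒦.T (𝒦.sharp a) d := by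
    rw [𝒦.cross_comm, T_cross_left_swap, cross_self, T_smul_left]
  have e2 : 𝒦.T (𝒦.cross a d) (𝒦.sharp a) = 𝒦.T (𝒦.cross (𝒦.sharp a) a) d := by
    rw [𝒦.cross_comm, T_cross_left_swap]
  have e3 : 𝒦.T (𝒦.cross a d) (𝒦.cross (𝒦.sharp a) a) =
      σ (𝒦.N a) * 𝒦.T a d + 𝒦.T a a * 𝒦.T (𝒦.sharp a) d := by
    rw [𝒦.cross_comm a d, ← T_cross_cross', 𝒦.cross_comm _ a, hE, T_add_left, T_smul_left, T_smul_left]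
  simp only [sub_eq_add_neg, ← neg_smul, T_add_left, T_add_right, T_smul_left, T_smul_right, e1, e2,
    e3, map_neg σ, map_add σ, map_mul, map_ofNat, hσ, T_conj]
  ring

include hσ hE in
theorem smul_cubeSnd (x : Alg 𝒦) :
    x.fst • cubeSnd x + cubeFst x • x.snd + 𝒦.cross (cubeSnd x) x.snd = 0 := by
  obtain ⟨s, a⟩ := x
  simp only [cubeSnd, cubeFst]
  have e1 := hE a a
  rw [𝒦.cross_comm a] at e1
  simp only [sub_eq_add_neg, ← neg_smul, add_cross, smul_cross, cross_self, e1, map_neg σ, map_add σ,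
    map_mul, map_ofNat, hσ, T_conj]
  module

include h2 h3 hσ hE in
theorem cross_cubeSnd (x : Alg 𝒦) (d : J) :
    𝒦.T d (cubeSnd x) • x.snd - 𝒦.T d x.snd • cubeSnd x
      + (2 * (σ x.fst * σ (𝒦.N x.snd) - x.fst * 𝒦.N x.snd)) • d
      + σ (cubeFst x) • 𝒦.cross x.snd d + σ x.fst • 𝒦.cross (cubeSnd x) d
      + 𝒦.cross (𝒦.cross (cubeSnd x) x.snd) d + 𝒦.cross (𝒦.cross (cubeSnd x) d) x.snd
      - 𝒦.cross (𝒦.cross x.snd d) (cubeSnd x) = 0 := by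
  obtain ⟨s, a⟩ := x
  simp only [cubeSnd, cubeFst]
  have e1 := hE a a
  rw [𝒦.cross_comm a] at e1
  have e2 := 𝒦.cross_cross_sharp h2 h3 hE a d
  have e3 := 𝒦.sharp_cross_cross h2 h3 a d
  have e4 := hE a d
  rw [𝒦.cross_comm a] at e4
  rw [𝒦.cross_comm (𝒦.sharp a)] at e3
  simp only [sub_eq_add_neg, ← neg_smul, add_cross, smul_cross, cross_add', cross_smul', cross_self,
    e1, e3, e4, T_add_right, T_smul_right, map_neg σ, map_add σ, map_mul, map_ofNat, hσ, T_conj]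
  linear_combination (norm := module) (2 : K) • e2

end Alg

end

end HermitianCubicNormStructure

/-! ### The triple product and skew form on 𝒜(𝒦). -/

namespace HermitianCubicNormStructure

namespace Alg

section

variable {F K J : Type*} [Field F] [CommRing K] [Algebra F K] {σ : K ≃ₐ[F] K}
  [AddCommGroup J] [Module K J] {𝒦 : HermitianCubicNormStructure σ J}

/-- The (skew) first component of `x ȳ - y x̄`. -/
def psi (x y : Alg 𝒦) : K :=
  x.fst * σ y.fst - y.fst * σ x.fst + 𝒦.T x.snd y.snd - 𝒦.T y.snd x.snd

/-- The symmetric triple product of `𝒜(𝒦)` attached to a skew element `k`. -/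
def tri (k : K) (x y z : Alg 𝒦) : Alg 𝒦 where
  fst := k * (x.fst * (𝒦.T y.snd z.snd + 𝒦.T z.snd y.snd)
    + y.fst * (𝒦.T x.snd z.snd + 𝒦.T z.snd x.snd)
    + z.fst * (𝒦.T x.snd y.snd + 𝒦.T y.snd x.snd)
    - 2 * (x.fst * z.fst * σ y.fst + z.fst * y.fst * σ x.fst + x.fst * y.fst * σ z.fst)
    - 2 * 𝒦.T (𝒦.cross x.snd y.snd) z.snd)
  snd := k • ((y.fst * σ z.fst + z.fst * σ y.fst - 𝒦.T y.snd z.snd - 𝒦.T z.snd y.snd) • x.snd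
    + (x.fst * σ z.fst + z.fst * σ x.fst - 𝒦.T x.snd z.snd - 𝒦.T z.snd x.snd) • y.snd
    + (x.fst * σ y.fst + y.fst * σ x.fst - 𝒦.T x.snd y.snd - 𝒦.T y.snd x.snd) • z.snd
    - (2 : K) • (σ z.fst • 𝒦.cross x.snd y.snd + σ x.fst • 𝒦.cross y.snd z.snd
      + σ y.fst • 𝒦.cross x.snd z.snd)
    + (2 : K) • (𝒦.cross (𝒦.cross x.snd y.snd) z.snd + 𝒦.cross (𝒦.cross y.snd z.snd) x.snd
      + 𝒦.cross (𝒦.cross x.snd z.snd) y.snd))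

theorem σ_psi (hσ : ∀ t, σ (σ t) = t) (x y : Alg 𝒦) : σ (psi x y) = -psi x y := by
  simp only [psi, map_sub, map_add, map_mul, hσ, T_conj]
  ring

theorem psi_swap (x y : Alg 𝒦) : psi x y = -psi y x := by
  simp only [psi]; ring

theorem psi_tri {k : K} (hk : σ k = -k) (hσ : ∀ t, σ (σ t) = t) (w x y z : Alg 𝒦) :
    psi w (tri k x y z) = psi x (tri k w y z) := by
  obtain ⟨r, d⟩ := w
  obtain ⟨s, a⟩ := x
  obtain ⟨t, b⟩ := y
  obtain ⟨u, c⟩ := z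
  simp only [psi, tri]
  -- Bring all cubic traces to a common normal form, so that the rest is ring arithmetic.
  have e1 : 𝒦.T d (𝒦.cross a b) = 𝒦.T a (𝒦.cross d b) := T_cross_swap ..
  have e2 : 𝒦.T d (𝒦.cross a c) = 𝒦.T a (𝒦.cross d c) := T_cross_swap ..
  have e3 : 𝒦.T (𝒦.cross a b) d = 𝒦.T (𝒦.cross d b) a := T_cross_left_swap ..
  have e4 : 𝒦.T (𝒦.cross a c) d = 𝒦.T (𝒦.cross d c) a := T_cross_left_swap ..
  have e5 : 𝒦.T d (𝒦.cross b c) = 𝒦.T c (𝒦.cross d b) := T_cross_rotate ..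
  have e6 : 𝒦.T a (𝒦.cross b c) = 𝒦.T c (𝒦.cross a b) := T_cross_rotate ..
  have e7 : 𝒦.T (𝒦.cross b c) d = 𝒦.T (𝒦.cross d b) c := by
    rw [← T_conj, e5, T_conj]
  have e8 : 𝒦.T (𝒦.cross b c) a = 𝒦.T (𝒦.cross a b) c := by
    rw [← T_conj, e6, T_conj]
  simp only [sub_eq_add_neg, ← neg_smul, T_add_left, T_add_right,
    T_smul_left, T_smul_right, T_cross_cross, T_cross_cross', 𝒦.cross_comm d a, e1, e2, e3, e4, e5,
    e6, e7, e8,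
    map_neg σ, map_add σ, map_mul σ, map_ofNat σ, hσ, hk, T_conj]
  ring

variable (h2 : IsUnit (2 : K)) (h3 : IsUnit (3 : K)) (hσ : ∀ t, σ (σ t) = t)
    (hE : ∀ a b, 𝒦.cross a (𝒦.cross (𝒦.sharp a) b) = σ (𝒦.N a) • b + 𝒦.T b a • 𝒦.sharp a)

include h2 in
theorem tri_self (k : K) (x : Alg 𝒦) :
    tri k x x x = ⟨6 * k * cubeFst x, (6 * k) • cubeSnd x⟩ := by
  obtain ⟨s, a⟩ := x
  have e : 𝒦.T (𝒦.sharp a) a = 3 * σ (𝒦.N a) := by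
    rw [← T_conj, T_sharp_self 𝒦 h2, map_mul, map_ofNat]
  ext
  · simp only [tri, cubeFst, cross_self, T_smul_left, e]
    ring
  · simp only [tri, cubeSnd, cross_self, smul_cross, map_ofNat]
    module

include h2 hσ hE in
theorem tri_cube_fst {k : K} (hk : σ k = -k) (x y : Alg 𝒦) :
    (tri k (tri k x x x) x y).fst =
      k * psi y x * (tri k x x x).fst + k * psi y (tri k x x x) * x.fst := by
  have f1 := T_cubeSnd_sub h2 hσ x
  have f2 := cubeFst_mul_T hσ hE x y.snd
  have f1' : x.fst * σ (cubeFst x) - σ x.fst * cubeFst x =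
     -2 * (x.fst * 𝒦.N x.snd - σ x.fst * σ (𝒦.N x.snd)) := by
    simp only [cubeFst, map_neg, map_sub, map_mul, map_ofNat, hσ, T_conj]
    ring
  have f3 : 𝒦.T (𝒦.cross (cubeSnd x) x.snd) y.snd = 𝒦.T (𝒦.cross x.snd y.snd) (cubeSnd x) := by
    rw [T_cross_left_swap, 𝒦.cross_comm]
  rw [tri_self h2]
  generalize cubeFst x = X at *
  generalize cubeSnd x = Y at *
  obtain ⟨s, a⟩ := x
  obtain ⟨q, d⟩ := y
  simp only [tri, psi, smul_cross, T_smul_left, T_smul_right, map_mul, map_ofNat, hk, f3] at *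
  linear_combination 6 * k ^ 2 * q * f1 + 12 * k ^ 2 * f2 + 18 * k ^ 2 * q * f1'

include h2 h3 hσ hE in
theorem tri_cube_snd {k : K} (hk : σ k = -k) (x y : Alg 𝒦) :
    (tri k (tri k x x x) x y).snd =
      (k * psi y x) • (tri k x x x).snd + (k * psi y (tri k x x x)) • x.snd := by
  have f1 := T_cubeSnd_sub h2 hσ x
  have f2 := smul_cubeSnd hσ hE x
  have f3 := cross_cubeSnd h2 h3 hσ hE x y.snd
  have f1' : x.fst * σ (cubeFst x) - σ x.fst * cubeFst x =
     -2 * (x.fst * 𝒦.N x.snd - σ x.fst * σ (𝒦.N x.snd)) := by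
    simp only [cubeFst, map_neg, map_sub, map_mul, map_ofNat, hσ, T_conj]
    ring
  rw [tri_self h2]
  generalize cubeFst x = X at *
  generalize cubeSnd x = Y at *
  obtain ⟨s, a⟩ := x
  obtain ⟨q, d⟩ := y
  simp only [tri, psi, smul_cross, cross_smul', T_smul_left, T_smul_right, map_mul, map_neg, map_ofNat, hk] at *
  linear_combination (norm := module) (12 * k ^ 2) • f3 + (12 * k ^ 2 * σ q) • f2
    - (6 * k ^ 2) • f1 • d - (6 * k ^ 2) • f1' • d

end

end Alg

end HermitianCubicNormStructure

/-! ### From the Freudenthal triple system to the structurable identity. -/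

namespace HermitianCubicNormStructure

namespace Alg

section

variable {F K J : Type*} [Field F] [CommRing K] [Algebra F K] {σ : K ≃ₐ[F] K}
  [AddCommGroup J] [Module K J] {𝒦 : HermitianCubicNormStructure σ J}

@[simp] theorem fst_sub (x y : Alg 𝒦) : (x - y).fst = x.fst - y.fst := rfl

@[simp] theorem snd_sub (x y : Alg 𝒦) : (x - y).snd = x.snd - y.snd := rfl

@[simp] theorem fst_neg (x : Alg 𝒦) : (-x).fst = -x.fst := rfl

@[simp] theorem snd_neg (x : Alg 𝒦) : (-x).snd = -x.snd := rfl

variable [Module F J]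

@[simp] theorem fst_conj (x : Alg 𝒦) : (conj (F := F) 𝒦 x).fst = σ x.fst := rfl

@[simp] theorem snd_conj (x : Alg 𝒦) : (conj (F := F) 𝒦 x).snd = x.snd := rfl

variable [IsScalarTower F K J]

/-- The form `k (x ȳ - y x̄)` with values in `F`, where `π : K → F` is a retraction. -/
def form (π : K →ₗ[F] F) (k : K) (x y : Alg 𝒦) : F := π (k * psi x y)

theorem form_smul_eq (hσ : ∀ t, σ (σ t) = t) {π : K →ₗ[F] F}
    (hπ : ∀ z, σ z = z → algebraMap F K (π z) = z) {k : K} (hk : σ k = -k) (x y z : Alg 𝒦) :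
    form π k x y • z = ⟨k * psi x y * z.fst, (k * psi x y) • z.snd⟩ := by
  have e : algebraMap F K (form π k x y) = k * psi x y :=
    hπ _ (by rw [map_mul, hk, σ_psi hσ]; ring)
  ext
  · rw [fst_smul, Algebra.smul_def, e]
  · rw [snd_smul, ← algebraMap_smul K (form π k x y), e]

theorem isFreudenthalTripleSystem (h2 : IsUnit (2 : K)) (h3 : IsUnit (3 : K))
    (hσ : ∀ t, σ (σ t) = t)
    (hE : ∀ a b, 𝒦.cross a (𝒦.cross (𝒦.sharp a) b) = σ (𝒦.N a) • b + 𝒦.T b a • 𝒦.sharp a)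
    {π : K →ₗ[F] F} (hπ : ∀ z, σ z = z → algebraMap F K (π z) = z) {k : K} (hk : σ k = -k) :
    IsFreudenthalTripleSystem (tri (𝒦 := 𝒦) k) (form π k) where
  tri_swap x y z := by
    ext
    · simp only [tri, 𝒦.cross_comm x.snd y.snd]; ring
    · simp only [tri, 𝒦.cross_comm x.snd y.snd]; module
  tri_comm x y z := by
    have e : 𝒦.T (𝒦.cross x.snd y.snd) z.snd = 𝒦.T (𝒦.cross x.snd z.snd) y.snd := by
      rw [𝒦.cross_comm, T_cross_left_swap, 𝒦.cross_comm, T_cross_left_swap, T_cross_left_swap]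
    ext
    · simp only [tri, e]; ring
    · simp only [tri, 𝒦.cross_comm y.snd z.snd]; module
  add_tri x x' y z := by
    ext
    · simp only [tri, fst_add, snd_add, T_add_left, T_add_right, add_cross, map_add σ]; ring
    · simp only [tri, fst_add, snd_add, T_add_left, T_add_right, add_cross, cross_add', map_add σ]
      module
  smul_tri r x y z := by
    ext
    · simp only [tri, fst_smul, snd_smul, Algebra.smul_def, ← algebraMap_smul K r x.snd,
        T_smul_left, T_smul_right, smul_cross, map_mul, AlgEquiv.commutes]
      ring
    · simp only [tri, fst_smul, snd_smul, Algebra.smul_def, ← algebraMap_smul K r (_ : J),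
        T_smul_left, T_smul_right, smul_cross, cross_smul', map_mul, AlgEquiv.commutes]
      module
  form_swap x y := by
    rw [form, form, psi_swap, mul_neg, map_neg]
  add_form x x' y := by
    rw [form, form, form, ← map_add]
    congr 1
    simp only [psi, fst_add, snd_add, T_add_left, T_add_right, map_add σ]
    ring
  smul_form r x y := by
    rw [form, form, ← smul_eq_mul (a := r), ← map_smul]
    congr 1
    simp only [psi, fst_smul, snd_smul, Algebra.smul_def, ← algebraMap_smul K r (_ : J),
        T_smul_left, T_smul_right, map_mul, AlgEquiv.commutes]
    ring
  form_tri w x y z := by rw [form, form, psi_tri hk hσ]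
  tri_cube x y := by
    rw [form_smul_eq hσ hπ hk, form_smul_eq hσ hπ hk]
    ext
    · exact tri_cube_fst h2 hσ hE hk x y
    · exact tri_cube_snd h2 h3 hσ hE hk x y

/-- Multiplication by `(k, 0)` from the left. -/
def kmul (k : K) (x : Alg 𝒦) : Alg 𝒦 := ⟨k * x.fst, k • x.snd⟩

theorem two_smul_V (hσ : ∀ t, σ (σ t) = t) {π : K →ₗ[F] F}
    (hπ : ∀ z, σ z = z → algebraMap F K (π z) = z) {k : K} (hk : σ k = -k)
    (h : IsFreudenthalTripleSystem (tri (𝒦 := 𝒦) k) (form π k)) (x y z : Alg 𝒦) :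
    (2 : F) • Structurable.V (conj 𝒦) x (kmul k y) z = h.der x y z + form π k y x • z := by
  rw [IsFreudenthalTripleSystem.der, form_smul_eq hσ hπ hk, form_smul_eq hσ hπ hk,
    form_smul_eq hσ hπ hk, two_smul, Structurable.V_apply]
  obtain ⟨s, a⟩ := x
  obtain ⟨t, b⟩ := y
  obtain ⟨r, c⟩ := z
  have e1 : 𝒦.T (𝒦.cross c b) a = 𝒦.T (𝒦.cross a b) c := T_cross_left_swap ..
  have e2 : 𝒦.T (𝒦.cross c a) b = 𝒦.T (𝒦.cross a b) c := by
    rw [T_cross_left_swap, 𝒦.cross_comm]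
  ext
  · simp only [tri, psi, kmul, fst_add, fst_sub, fst_mul, snd_mul, fst_conj, snd_conj, T_add_left,
      T_smul_left, T_smul_right, cross_smul', map_mul σ, map_neg σ, hk, e1, e2, hσ]
    ring
  · simp only [tri, psi, kmul, snd_add, snd_sub, fst_mul, snd_mul, fst_conj, snd_conj, add_cross,
      smul_cross, cross_smul', T_smul_right, map_mul σ, map_neg σ, hk, hσ,
      𝒦.cross_comm b a, 𝒦.cross_comm c b, 𝒦.cross_comm c a]
    module

/-- Swapping the indices of V amounts, after conjugation by k, to changing the sign of S_{x,y}. This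
computes the inner operator V_{y,x}(w) of the structurable identity. -/
theorem two_smul_V_kmul (hσ : ∀ t, σ (σ t) = t) {π : K →ₗ[F] F}
    (hπ : ∀ z, σ z = z → algebraMap F K (π z) = z) {k : K} (hk : σ k = -k)
    (h : IsFreudenthalTripleSystem (tri (𝒦 := 𝒦) k) (form π k)) (x y z : Alg 𝒦) :
    (2 : F) • Structurable.V (conj 𝒦) (kmul k y) x (kmul k z) =
      kmul k (-h.der x y z + form π k y x • z) := by
  rw [IsFreudenthalTripleSystem.der, form_smul_eq hσ hπ hk, form_smul_eq hσ hπ hk,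
    form_smul_eq hσ hπ hk, two_smul, Structurable.V_apply]
  obtain ⟨s, a⟩ := x
  obtain ⟨t, b⟩ := y
  obtain ⟨r, c⟩ := z
  have e1 : 𝒦.T (𝒦.cross c b) a = 𝒦.T (𝒦.cross a b) c := T_cross_left_swap ..
  have e2 : 𝒦.T (𝒦.cross c a) b = 𝒦.T (𝒦.cross a b) c := by
    rw [T_cross_left_swap, 𝒦.cross_comm]
  ext
  · simp only [tri, psi, kmul, fst_add, fst_neg, fst_sub, fst_mul, snd_mul, fst_conj, snd_conj, T_add_left,
      T_smul_left, T_smul_right, cross_smul', smul_cross, map_mul σ, map_neg σ, hk, e1, e2, hσ,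
      𝒦.cross_comm b a]
    ring
  · simp only [tri, psi, kmul, snd_add, snd_neg, snd_sub, fst_mul, snd_mul, fst_conj, snd_conj, add_cross,
      smul_cross, cross_smul', T_smul_left, T_smul_right, map_mul σ, map_neg σ, hk, hσ,
      𝒦.cross_comm b a, 𝒦.cross_comm c b, 𝒦.cross_comm c a]
    module

theorem bracket_V (h2 : (2 : F) ≠ 0) (h3 : (3 : F) ≠ 0) (hσ : ∀ t, σ (σ t) = t) {π : K →ₗ[F] F}
    (hπ : ∀ z, σ z = z → algebraMap F K (π z) = z) {k : K} (hk : σ k = -k)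
    {μ : F} (hμ : μ ≠ 0) (hkk : k * k = algebraMap F K μ)
    (h : IsFreudenthalTripleSystem (tri (𝒦 := 𝒦) k) (form π k)) (x y z w : Alg 𝒦) :
    ⁅Structurable.V (conj 𝒦) x y, Structurable.V (conj 𝒦) z w⁆ =
      Structurable.V (conj 𝒦) (Structurable.V (conj 𝒦) x y z) w -
        Structurable.V (conj 𝒦) z (Structurable.V (conj 𝒦) y x w) := by
  have hsmul (y : Alg 𝒦) : y = μ⁻¹ • kmul k (kmul k y) := by
    have e : algebraMap F K μ⁻¹ * (k * k) = 1 := by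
      rw [hkk, ← map_mul, inv_mul_cancel₀ hμ, map_one]
    ext
    · simp only [kmul, fst_smul, Algebra.smul_def]
      linear_combination -e * y.fst
    · simp only [kmul, snd_smul, ← algebraMap_smul K μ⁻¹ (_ : J)]
      linear_combination (norm := module) -e • y.snd
  -- As k² = μ is a nonzero scalar, y and w may be replaced by ky and kw.
  have hsurj (y : Alg 𝒦) : ∃ y', y = kmul k y' := by
    refine ⟨μ⁻¹ • kmul k y, ?_⟩
    conv_lhs => rw [hsmul y]
    ext
    · simp only [kmul, fst_smul, Algebra.smul_def]; ring
    · simp only [kmul, snd_smul, ← algebraMap_smul K μ⁻¹ (_ : J)]; module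
  have hinj {y y' : Alg 𝒦} (e : kmul k y = kmul k y') : y = y' := by
    have e1 := congrArg (μ⁻¹ • kmul k ·) e
    rwa [← hsmul, ← hsmul] at e1
  obtain ⟨y, rfl⟩ := hsurj y
  obtain ⟨w, rfl⟩ := hsurj w
  have V1 := two_smul_V hσ hπ hk h
  have V2 := two_smul_V_kmul hσ hπ hk h x y w
  set X := Structurable.V (conj 𝒦) x (kmul k y) z with hX
  obtain ⟨Y, hY⟩ := hsurj (Structurable.V (conj 𝒦) (kmul k y) x (kmul k w))
  rw [hY] at V2 ⊢
  have hXX : (2 : F) • X = h.der x y z + form π k y x • z := V1 x y z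
  have hYY : (2 : F) • Y = -h.der x y w + form π k y x • w := by
    apply hinj
    rw [← V2]
    ext
    · simp only [kmul, fst_smul, Algebra.smul_def]; ring
    · simp only [kmul, snd_smul, ← algebraMap_smul K (2 : F) (_ : J)]; module
  ext1 v
  rw [Ring.lie_def, LinearMap.sub_apply, LinearMap.sub_apply, Module.End.mul_apply,
    Module.End.mul_apply]
  apply smul_right_injective (Alg 𝒦) h2
  apply smul_right_injective (Alg 𝒦) h2
  simp only [smul_sub]
  rw [V1, V1, smul_add, smul_add, ← h.der_smul, ← h.der_smul, smul_comm (2 : F), smul_comm (2 : F),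
    V1, V1, V1, V1]
  -- The scalar part φ(y,x) contributes equally to X and Y and drops out of the difference; skewness
  -- of S_{x,y} removes the remaining form terms.
  have d1 : (2 : F) • h.der X w v = h.der (h.der x y z) w v + form π k y x • h.der z w v := by
    rw [← h.der_smul_left, hXX, h.der_add_left, h.der_smul_left]
  have d2 : (2 : F) • h.der z Y v = -h.der z (h.der x y w) v + form π k y x • h.der z w v := by
    rw [← h.der_smul_mid, hYY, h.der_add_mid, h.der_smul_mid, ← neg_one_smul F, h.der_smul_mid,
      neg_one_smul]
  have d3 : (2 : F) * form π k w X = form π k w (h.der x y z) + form π k y x * form π k w z := by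
    rw [← h.form_smul, hXX, h.form_add, h.form_smul]
  have d4 : (2 : F) * form π k Y z = -form π k (h.der x y w) z + form π k y x * form π k w z := by
    rw [← h.smul_form, hYY, h.add_form, h.smul_form, ← neg_one_smul F, h.smul_form, neg_one_mul]
  have d5 := h.form_der x y w z
  have d6 := h.der_der h2 h3 x y z w v
  rw [h.der_add, h.der_add, h.der_smul, h.der_smul]
  linear_combination (norm := module) d6 - d1 + d2 - (d3 - d4 + d5) • v

end

end Alg

end HermitianCubicNormStructure

/-! ### Skew-dimension, centrality and simplicity. -/

namespace HermitianCubicNormStructure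

namespace Alg

section

variable {F K J : Type*} [Field F] [CommRing K] [Algebra F K] {σ : K ≃ₐ[F] K}
  [AddCommGroup J] [Module F J] [Module K J] [IsScalarTower F K J]
  {𝒦 : HermitianCubicNormStructure σ J} {k : K} {μ : F}

omit [IsScalarTower F K J] in
theorem bar_mul (hσ : ∀ t, σ (σ t) = t) (x y : Alg 𝒦) :
    conj (F := F) 𝒦 (x * y) = conj (F := F) 𝒦 y * conj (F := F) 𝒦 x := by
  ext
  · simp only [fst_conj, fst_mul, snd_conj, map_add σ, map_mul σ, T_conj]; ring
  · simp only [snd_conj, snd_mul, fst_conj, hσ, 𝒦.cross_comm x.snd]; module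

omit [IsScalarTower F K J] in
theorem hasSkewDimensionOne [Nontrivial K] (h2 : (2 : F) ≠ 0) (hk0 : k ≠ 0) (hk : σ k = -k)
    (hspan : ∀ z : K, ∃ α β : F, z = algebraMap F K α + algebraMap F K β * k) :
    Structurable.HasSkewDimensionOne (conj (F := F) 𝒦) := by
  refine finrank_eq_one (⟨⟨k, 0⟩, ?_⟩ : Structurable.skew (conj (F := F) 𝒦)) ?_ ?_
  · change conj (F := F) 𝒦 ⟨k, 0⟩ = -⟨k, 0⟩
    ext <;> simp [hk]
  · intro h
    exact hk0 (congrArg fst (congrArg Subtype.val h))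
  · rintro ⟨⟨s, a⟩, hx⟩
    change conj (F := F) 𝒦 ⟨s, a⟩ = -⟨s, a⟩ at hx
    have e1 : σ s = -s := congrArg fst hx
    have e2 : a = -a := congrArg snd hx
    obtain ⟨α, β, rfl⟩ := hspan s
    refine ⟨β, Subtype.ext ?_⟩
    have h2K : IsUnit (2 : K) := by
      simpa only [map_ofNat] using (IsUnit.mk0 _ h2).map (algebraMap F K)
    have hα : algebraMap F K α = 0 := by
      rw [map_add, map_mul, AlgEquiv.commutes, AlgEquiv.commutes, hk] at e1
      apply h2K.mul_left_cancel
      linear_combination e1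
    have ha : a = 0 := by
      apply h2K.smul_left_cancel.1
      linear_combination (norm := module) e2
    ext
    · change β • k = algebraMap F K α + algebraMap F K β * k
      rw [hα, zero_add, Algebra.smul_def]
    · change β • (0 : J) = a
      rw [ha, smul_zero]

theorem isCentral (h2 : (2 : F) ≠ 0) (hμ : μ ≠ 0) (hkk : k * k = algebraMap F K μ) (hk : σ k = -k)
    (hfix : ∀ z, σ z = z → ∃ α, z = algebraMap F K α) :
    Structurable.IsCentral (conj (F := F) 𝒦) := by
  have h2k : IsUnit (2 * k) := by
    have hku : IsUnit (k * k) := hkk ▸ (IsUnit.mk0 _ hμ).map (algebraMap F K)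
    have h2K : IsUnit (2 : K) := by
      simpa only [map_ofNat] using (IsUnit.mk0 _ h2).map (algebraMap F K)
    exact h2K.mul (isUnit_of_mul_isUnit_left hku)
  ext x
  constructor
  · rintro ⟨h1, hcomm, -⟩
    obtain ⟨r, hr⟩ := hfix x.fst (congrArg fst h1)
    -- Commuting with (k,0) gives 2ka = 0 for the J-component a.
    have e := congrArg snd (hcomm ⟨k, 0⟩)
    simp only [snd_mul, hk, smul_zero, cross_zero, zero_cross] at e
    have ha : x.snd = 0 := by
      apply h2k.smul_left_cancel.1
      linear_combination (norm := module) -e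
    refine ⟨r, ?_⟩
    ext
    · simp [hr, Algebra.smul_def]
    · simp [ha]
  · rintro ⟨r, rfl⟩
    refine ⟨?_, fun a => ?_, fun a b => ?_, fun a b => ?_, fun a b => ?_⟩
    · ext <;> simp
    · rw [smul_one_mul, mul_smul_comm, mul_one]
    · rw [associator_apply, smul_one_mul, smul_one_mul, smul_mul_assoc, sub_self]
    · rw [associator_apply, mul_smul_comm, mul_one, smul_one_mul, smul_mul_assoc, mul_smul_comm,
        sub_self]
    · rw [associator_apply, mul_smul_comm, mul_one, mul_smul_comm, mul_one, mul_smul_comm, sub_self]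

omit [IsScalarTower F K J] in
theorem isSimple [Nontrivial K] (h2 : (2 : F) ≠ 0) (hμ : μ ≠ 0) (hkk : k * k = algebraMap F K μ)
    (hk : σ k = -k) (hspan : ∀ z : K, ∃ α β : F, z = algebraMap F K α + algebraMap F K β * k)
    (hT : 𝒦.T.SeparatingLeft) : Structurable.IsSimple (conj (F := F) 𝒦) where
  nontrivial := ⟨1, 0, fun h => one_ne_zero (congrArg fst h)⟩
  eq_bot_or_eq_top I hI := by
    have hbar {x : Alg 𝒦} (hx : x ∈ I) : conj (F := F) 𝒦 x ∈ I :=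
      hI.map_bar ▸ Submodule.mem_map_of_mem hx
    have hscalar {α : F} (hα : α ≠ 0) (h : (⟨algebraMap F K α, 0⟩ : Alg 𝒦) ∈ I) : I = ⊤ := by
      rw [eq_top_iff]
      intro x _
      have : (1 : Alg 𝒦) ∈ I := by
        convert I.smul_mem α⁻¹ h using 1
        ext
        · simp [Algebra.smul_def, ← map_mul, hα]
        · simp
      simpa using hI.mul_mem_right _ this x
    -- K may be split, so s need not be invertible. For s = α + βk, a nonzero scalar in the ideal is
    -- s + σ(s) = 2α, or sk = βμ when α = 0.
    have hfst {s : K} (hs : s ≠ 0) (h : (⟨s, 0⟩ : Alg 𝒦) ∈ I) : I = ⊤ := by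
      obtain ⟨α, β, rfl⟩ := hspan s
      by_cases hα : α = 0
      · subst hα
        have hβ : β ≠ 0 := by
          rintro rfl
          simp at hs
        apply hscalar (mul_ne_zero hβ hμ)
        convert hI.mul_mem_right _ h ⟨k, 0⟩ using 1
        ext
        · simp only [fst_mul, map_zero, map_mul, ← hkk]; ring
        · simp [zero_cross]
      · apply hscalar (mul_ne_zero h2 hα)
        convert I.add_mem h (hbar h) using 1
        ext
        · simp only [fst_add, fst_conj, map_add, map_mul, AlgEquiv.commutes, hk, map_ofNat]; ring
        · simp
    -- The anticommutator with (k,0) kills J and multiplies K by 2k; a further factor k makes this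
    -- the scalar 2μ.
    have hproj {x : Alg 𝒦} (hx : x ∈ I) : (⟨x.fst, 0⟩ : Alg 𝒦) ∈ I := by
      have e1 := I.add_mem (hI.mul_mem_left _ hx ⟨k, 0⟩) (hI.mul_mem_right _ hx ⟨k, 0⟩)
      have e2 := I.smul_mem (2 * μ)⁻¹ (hI.mul_mem_left _ e1 ⟨k, 0⟩)
      convert e2 using 1
      have e : algebraMap F K (2 * μ)⁻¹ * (2 * (k * k)) = 1 := by
        rw [hkk, ← map_ofNat (algebraMap F K) 2, ← map_mul, ← map_mul,
          inv_mul_cancel₀ (mul_ne_zero h2 hμ), map_one]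
      ext
      · simp only [fst_smul, fst_mul, fst_add, snd_add, snd_mul, map_zero,
          LinearMap.zero_apply, Algebra.smul_def]
        linear_combination -e * x.fst
      · simp [hk, zero_cross, cross_zero]
    by_contra! hne
    obtain ⟨x, hx, hx0⟩ := (Submodule.ne_bot_iff I).1 hne.1
    by_cases hs : x.fst = 0
    · have ha : x.snd ≠ 0 := fun ha => hx0 (Alg.ext hs ha)
      obtain ⟨c, hc⟩ : ∃ c, 𝒦.T x.snd c ≠ 0 := by
        by_contra! hc
        exact ha (hT _ hc)
      refine hne.2 (hfst ?_ (hproj (hI.mul_mem_right _ hx ⟨0, c⟩)))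
      simpa using hc
    · exact hne.2 (hfst hs (hproj hx))

end

end Alg

end HermitianCubicNormStructure

theorem mainTheorem3 {F K J : Type*} [Field F] (hF2 : ringChar F ≠ 2) (hF3 : ringChar F ≠ 3)
    [CommRing K] [Algebra F K] [Algebra.IsQuadraticExtension F K] [Algebra.Etale F K]
    (σ : K ≃ₐ[F] K) (hσ : σ ≠ AlgEquiv.refl)
    [AddCommGroup J] [Module F J] [Module K J] [IsScalarTower F K J]
    (𝒦 : HermitianCubicNormStructure σ J) :
    Structurable.IsStructurable (HermitianCubicNormStructure.Alg.conj 𝒦) ∧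
      Structurable.HasSkewDimensionOne (HermitianCubicNormStructure.Alg.conj 𝒦) ∧
      (𝒦.T.Nondegenerate →
        Structurable.IsCentral (HermitianCubicNormStructure.Alg.conj 𝒦) ∧
          Structurable.IsSimple (HermitianCubicNormStructure.Alg.conj 𝒦)) := by
  have h2 : (2 : F) ≠ 0 := Ring.two_ne_zero hF2
  have h3 : (3 : F) ≠ 0 := by
    intro h
    have hd : ringChar F ∣ 3 := ringChar.dvd (by exact_mod_cast h)
    rcases (Nat.dvd_prime Nat.prime_three).1 hd with h1 | h1
    · exact CharP.ringChar_ne_one h1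
    · exact hF3 h1
  have h2K : IsUnit (2 : K) := by
    simpa only [map_ofNat] using (IsUnit.mk0 _ h2).map (algebraMap F K)
  have h3K : IsUnit (3 : K) := by
    simpa only [map_ofNat] using (IsUnit.mk0 _ h3).map (algebraMap F K)
  have hnt : Nontrivial K := Module.nontrivial_of_finrank_pos (R := F)
    (by rw [Algebra.IsQuadraticExtension.finrank_eq_two F K]; norm_num)
  have hred : IsReduced K := Algebra.FormallyUnramified.isReduced_of_field F K
  obtain ⟨k, μ, hμ, hkk, hk, hspan⟩ := exists_skew_generator h2 σ hσ
  have hk0 : k ≠ 0 := by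
    rintro rfl
    rw [zero_mul, eq_comm, map_eq_zero] at hkk
    exact hμ hkk
  have hσσ (t : K) : σ (σ t) = t := by
    obtain ⟨α, β, rfl⟩ := hspan t
    simp [hk]
  have hfix (z : K) (hz : σ z = z) : ∃ α, z = algebraMap F K α := by
    obtain ⟨α, β, rfl⟩ := hspan z
    refine ⟨α, ?_⟩
    rw [map_add, map_mul, AlgEquiv.commutes, AlgEquiv.commutes, hk] at hz
    rw [add_eq_left]
    apply h2K.mul_left_cancel
    linear_combination -hz
  have hK (z : K) (hz : σ z = z) : z = 0 ∨ IsUnit z := by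
    obtain ⟨α, rfl⟩ := hfix z hz
    rcases eq_or_ne α 0 with rfl | hα
    · exact .inl (map_zero _)
    · exact .inr ((IsUnit.mk0 _ hα).map (algebraMap F K))
  -- Any F-linear retraction will do: it is only evaluated on elements fixed by σ, which already lie
  -- in F.
  obtain ⟨π, hπ⟩ := (Algebra.linearMap F K).exists_leftInverse_of_injective
    (LinearMap.ker_eq_bot.2 (algebraMap F K).injective)
  have hπ' (z : K) (hz : σ z = z) : algebraMap F K (π z) = z := by
    obtain ⟨α, rfl⟩ := hfix z hz
    exact congrArg (algebraMap F K) (LinearMap.congr_fun hπ α)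
  have hE := 𝒦.cross_sharp_cross h2K h3K hσσ hK
  have h := HermitianCubicNormStructure.Alg.isFreudenthalTripleSystem h2K h3K hσσ hE hπ' hk
  refine ⟨⟨fun x => ?_, HermitianCubicNormStructure.Alg.bar_mul hσσ,
    HermitianCubicNormStructure.Alg.bracket_V h2 h3 hσσ hπ' hk hμ hkk h⟩,
    HermitianCubicNormStructure.Alg.hasSkewDimensionOne h2 hk0 hk hspan, fun hT =>
      ⟨HermitianCubicNormStructure.Alg.isCentral h2 hμ hkk hk hfix,
        HermitianCubicNormStructure.Alg.isSimple h2 hμ hkk hk hspan hT.1⟩⟩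
  ext
  · exact hσσ x.fst
  · rfl
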